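/- Let $E$ be a real Banach lattice, and let $L(E)$ be the algebra of bounded linear operators on $E$. A bounded set $A\subseteq E$ is called limited if every weak-$*$ null sequence in the dual $E'$ converges to $0$ uniformly on $A$. A set $A\subseteq E$ is called an Lwc-set if every disjoint sequence in its solid hull $\bigcup_{a\in A}[-|a|,|a|]$ is norm null. An operator $T\in L(E)$ is called l-Lwc (limitedly L-weakly compact) if it carries limited sets onto Lwc-sets, and r-l-Lwc if $T=T_1-T_2$ with $T_1,T_2$ positive l-Lwc operators. Write $\text{r-l-Lwc}(E)$ for the set of r-l-Lwc operators on $E$, and let $L_r(E)$ be the algebra of regular operators on $E$ (differences of two positive operators), ordered by $S\le T$ iff $T-S$ is positive. Then the following hold. (i) $\text{r-l-Lwc}(E)$ is a (not necessarily unital) subalgebra of $L_r(E)$. Moreover, $\text{r-l-Lwc}(E)=L_r(E)$ if and only if the identity operator $I_E$ is l-Lwc. (ii) Suppose that $E$ is Dedekind complete. Then every $T\in L_r(E)$ has a modulus $|T|=T\vee(-T)$ in $L_r(E)$, and $L_r(E)$ is a Banach lattice under the regular norm $\|T\|_r:=\|\,|T|\,\|$. The set $\text{r-l-Lwc}(E)$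 is a $\|\cdot\|_r$-closed order ideal of $L_r(E)$: it is a linear subspace, it contains every $S\in L_r(E)$ with $|S|\le|T|$ for some $T\in\text{r-l-Lwc}(E)$, and it is closed for $\|\cdot\|_r$. In particular $(\text{r-l-Lwc}(E),\|\cdot\|_r)$ is complete. Finally, $\|ST\|_r\le\|S\|_r\,\|T\|_r$ for all $S,T\in L_r(E)$. -/

import Mathlib

open Filter Topology

/-! ### Banach spaces and Banach lattices -/

/-- A bounded subset `A` of a Banach space `X` is limited if every weak-star null sequence in the
dual of `X` converges to zero uniformly on `A`. -/
def IsLimitedSet {X : Type*} [NormedAddCommGroup X] [NormedSpace ℝ X] (A : Set X) : Prop :=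
  Bornology.IsBounded A ∧
    ∀ f : ℕ → WeakDual ℝ X, Tendsto f atTop (𝓝 0) →
      TendstoUniformlyOn (fun n x => f n x) (fun _ => (0 : ℝ)) atTop A

/-- `A` is an Lwc-set if every disjoint sequence in its solid hull
`sol A = ⋃ a ∈ A, [-|a|, |a|]` is norm null. -/
def IsLwcSet {F : Type*} [NormedAddCommGroup F] [Lattice F] (A : Set F) : Prop :=
  ∀ a : ℕ → F, (∀ n, a n ∈ ⋃ x ∈ A, Set.Icc (-|x|) |x|) →
    (∀ m n, m ≠ n → |a m| ⊓ |a n| = 0) → Tendsto a atTop (𝓝 0)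

/-- `T` is limitedly L-weakly compact (l-Lwc): it carries limited sets onto Lwc-sets. -/
def IsLimitedlyLwc {X F : Type*} [NormedAddCommGroup X] [NormedSpace ℝ X]
    [NormedAddCommGroup F] [NormedSpace ℝ F] [Lattice F] (T : X →L[ℝ] F) : Prop :=
  ∀ A : Set X, IsLimitedSet A → IsLwcSet (T '' A)

/-- Every nonempty subset that is bounded above has a supremum. -/
def IsDedekindComplete (E : Type*) [PartialOrder E] : Prop :=
  ∀ s : Set E, s.Nonempty → BddAbove s → ∃ u, IsLUB s u

/-- The operator `T` maps the positive cone into the positive cone. -/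
def IsPositiveOperator {E F : Type*} [NormedAddCommGroup E] [NormedSpace ℝ E] [Lattice E]
    [NormedAddCommGroup F] [NormedSpace ℝ F] [Lattice F] (T : E →L[ℝ] F) : Prop :=
  ∀ x, 0 ≤ x → 0 ≤ T x

/-- `T` is a regularly-l-Lwc operator: a difference of two positive l-Lwc operators. -/
def IsRegularlyLimitedlyLwc {E F : Type*} [NormedAddCommGroup E] [NormedSpace ℝ E] [Lattice E]
    [NormedAddCommGroup F] [NormedSpace ℝ F] [Lattice F] (T : E →L[ℝ] F) : Prop :=
  ∃ T₁ T₂ : E →L[ℝ] F, IsPositiveOperator T₁ ∧ IsLimitedlyLwc T₁ ∧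
    IsPositiveOperator T₂ ∧ IsLimitedlyLwc T₂ ∧ T = T₁ - T₂

/-! ### Moduli and Banach lattice norms on an ordered vector space -/

/-- The modulus `|x| = x ∨ (-x)` in an ordered vector space: the supremum of `{x, -x}`
(by convention `0` when this supremum does not exist). -/
noncomputable def orderModulus {V : Type*} [AddCommGroup V] [PartialOrder V] (x : V) : V :=
  open scoped Classical in
  if h : ∃ u, IsLUB {x, -x} u then h.choose else 0

/-- The function `N` on the (partially) ordered real vector space `V` makes `V` a Banach lattice:
`V` is a vector lattice, `N` is a norm, `N` is a lattice norm, and `V` is complete under `N`. -/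
structure IsBanachLatticeNorm {V : Type*} [AddCommGroup V] [Module ℝ V] [PartialOrder V]
    (N : V → ℝ) : Prop where
  add_le_add_right : ∀ x y z : V, x ≤ y → x + z ≤ y + z
  smul_le_smul : ∀ (c : ℝ) (x y : V), 0 ≤ c → x ≤ y → c • x ≤ c • y
  exists_sup : ∀ x y : V, ∃ u, IsLUB {x, y} u
  exists_inf : ∀ x y : V, ∃ u, IsGLB {x, y} u
  nonneg : ∀ x, 0 ≤ N x
  eq_zero_iff : ∀ x, N x = 0 ↔ x = 0
  smul : ∀ (c : ℝ) (x : V), N (c • x) = |c| * N x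
  add_le : ∀ x y, N (x + y) ≤ N x + N y
  solid : ∀ x y, orderModulus x ≤ orderModulus y → N x ≤ N y
  complete : ∀ u : ℕ → V,
    (∀ ε : ℝ, 0 < ε → ∃ n₀, ∀ m, n₀ ≤ m → ∀ n, n₀ ≤ n → N (u m - u n) < ε) →
      ∃ x, Tendsto (fun n => N (u n - x)) atTop (𝓝 0)

/-! ### The algebra of regular operators -/

section Regular

variable (E : Type*) [NormedAddCommGroup E] [NormedSpace ℝ E] [Lattice E]
  [IsOrderedAddMonoid E] [IsOrderedModule ℝ E]

/-- The algebra `L_r(E)` of regular operators on `E`: differences of two positive operators. -/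
def RegularOperators : Subalgebra ℝ (E →L[ℝ] E) where
  carrier := {T | ∃ T₁ T₂ : E →L[ℝ] E,
    IsPositiveOperator T₁ ∧ IsPositiveOperator T₂ ∧ T = T₁ - T₂}
  add_mem' := by
    rintro _ _ ⟨A, B, hA, hB, rfl⟩ ⟨C, D, hC, hD, rfl⟩
    exact ⟨A + C, B + D, fun x hx => add_nonneg (hA x hx) (hC x hx),
      fun x hx => add_nonneg (hB x hx) (hD x hx), by abel⟩
  mul_mem' := by
    rintro _ _ ⟨A, B, hA, hB, rfl⟩ ⟨C, D, hC, hD, rfl⟩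
    exact ⟨A * C + B * D, A * D + B * C,
      fun x hx => add_nonneg (hA _ (hC x hx)) (hB _ (hD x hx)),
      fun x hx => add_nonneg (hA _ (hD x hx)) (hB _ (hC x hx)), by noncomm_ring⟩
  algebraMap_mem' := by
    intro r
    refine ⟨max r 0 • 1, max (-r) 0 • 1, fun x hx => smul_nonneg (le_max_right _ _) hx,
      fun x hx => smul_nonneg (le_max_right _ _) hx, ?_⟩
    rw [← sub_smul, Algebra.algebraMap_eq_smul_one]
    congr 1
    rcases le_total r 0 with h | h
    · simp [h]
    · simp [h]

/-- The operator order on `L_r(E)`: `S ≤ T` iff `T - S` is positive. -/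
instance RegularOperators.instPartialOrder : PartialOrder (RegularOperators E) where
  le S T := IsPositiveOperator ((T : E →L[ℝ] E) - (S : E →L[ℝ] E))
  le_refl S x _ := by simp
  le_trans R S T hRS hST x hx := by simpa using add_nonneg (hRS x hx) (hST x hx)
  le_antisymm S T hST hTS := by
    have h : ∀ x : E, 0 ≤ x → (S : E →L[ℝ] E) x = (T : E →L[ℝ] E) x := fun x hx =>
      le_antisymm (sub_nonneg.1 (hST x hx)) (sub_nonneg.1 (hTS x hx))
    ext x
    rw [← posPart_sub_negPart x, map_sub, map_sub, h _ (posPart_nonneg x),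
      h _ (negPart_nonneg x)]

variable {E}

/-- The regular norm `‖T‖_r = ‖ |T| ‖` on `L_r(E)`. -/
noncomputable def regularNorm (T : RegularOperators E) : ℝ :=
  ‖((orderModulus T : RegularOperators E) : E →L[ℝ] E)‖

end Regular

set_option linter.unusedSectionVars false

/-! ### Vector lattices -/

section VectorLattice

variable {F : Type*} [AddCommGroup F] [Lattice F] [IsOrderedAddMonoid F]

theorem neg_abs_le_iff_abs_le {a b : F} : a ∈ Set.Icc (-b) b ↔ |a| ≤ b := by
  rw [Set.mem_Icc, abs_le', and_comm, neg_le]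

theorem abs_sub_inf_le {a u w : F} (hw : 0 ≤ w) (h : a ≤ u + w) : a - a ⊓ u ≤ w := by
  rw [sub_le_iff_le_add', inf_add]
  exact le_inf (le_add_of_nonneg_right hw) h

theorem inf_eq_zero_of_le {a b c d : F} (ha : 0 ≤ a) (hb : 0 ≤ b) (hac : a ≤ c) (hbd : b ≤ d)
    (h : c ⊓ d = 0) : a ⊓ b = 0 :=
  le_antisymm (h ▸ inf_le_inf hac hbd) (le_inf ha hb)

/-- The Riesz decomposition property. -/
theorem exists_add_of_abs_le_add {z u v : F} (hu : 0 ≤ u) (hv : 0 ≤ v) (h : |z| ≤ u + v) :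
    ∃ a b, |a| ≤ u ∧ |b| ≤ v ∧ z = a + b := by
  obtain ⟨h₁, h₂⟩ := abs_le'.1 h
  refine ⟨(z ⊓ u) ⊔ -u, z - (z ⊓ u) ⊔ -u, abs_le'.2 ⟨?_, ?_⟩, abs_le'.2 ⟨?_, ?_⟩, by abel⟩
  · exact sup_le inf_le_right ((neg_nonpos.2 hu).trans hu)
  · rw [neg_le]
    exact le_sup_right
  · rw [sub_le_comm]
    refine le_trans (le_inf (sub_le_self _ hv) ?_) le_sup_left
    rwa [sub_le_iff_le_add]
  · rw [neg_sub, sub_le_iff_le_add']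
    refine sup_le (inf_le_left.trans (le_add_of_nonneg_right hv)) ?_
    rw [neg_le_iff_add_nonneg] at h₂ ⊢
    convert h₂ using 1
    abel

theorem abs_real_smul [Module ℝ F] [IsOrderedModule ℝ F] (c : ℝ) (x : F) :
    |c • x| = |c| • |x| := by
  have hpos : ∀ c : ℝ, 0 < c → |c • x| = c • |x| := fun c hc => by
    have := (OrderIso.smulRight (β := F) hc).map_sup x (-x)
    simp only [OrderIso.smulRight_apply, smul_neg] at this
    exact this.symm
  rcases lt_trichotomy c 0 with hc | rfl | hc
  · rw [abs_of_neg hc, ← hpos _ (neg_pos.2 hc), neg_smul, abs_neg]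
  · simp
  · rw [abs_of_pos hc, hpos c hc]

theorem smul_inf_smul_eq_zero [Module ℝ F] [IsOrderedModule ℝ F] {a b : F} {k l : ℝ}
    (ha : 0 ≤ a) (hb : 0 ≤ b) (hk : 0 ≤ k) (hl : 0 ≤ l) (h : a ⊓ b = 0) :
    (k • a) ⊓ (l • b) = 0 := by
  have hm : 0 < max (max k l) 1 := lt_max_of_lt_right one_pos
  refine inf_eq_zero_of_le (c := max (max k l) 1 • a) (d := max (max k l) 1 • b)
    (smul_nonneg hk ha) (smul_nonneg hl hb)
    (smul_le_smul_of_nonneg_right ((le_max_left _ _).trans (le_max_left _ _)) ha)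
    (smul_le_smul_of_nonneg_right ((le_max_right _ _).trans (le_max_left _ _)) hb) ?_
  have := (OrderIso.smulRight (β := F) hm).map_inf a b
  simpa [h] using this.symm

end VectorLattice

/-! ### Elements of order continuous norm -/

section LwcElement

variable {F : Type*} [NormedAddCommGroup F] [Lattice F] [IsOrderedAddMonoid F]

theorem isLwcSet_singleton_iff {x : F} : IsLwcSet {x} ↔
    ∀ a : ℕ → F, (∀ n, |a n| ≤ |x|) → (∀ m n, m ≠ n → |a m| ⊓ |a n| = 0) →
      Tendsto a atTop (𝓝 0) := by
  simp only [IsLwcSet, Set.mem_singleton_iff, Set.iUnion_iUnion_eq_left, neg_abs_le_iff_abs_le]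

theorem isLwcSet_singleton_of_abs_le {x y : F} (hx : IsLwcSet {x}) (h : |y| ≤ |x|) :
    IsLwcSet {y} := by
  rw [isLwcSet_singleton_iff] at hx ⊢
  exact fun a ha => hx a fun n => (ha n).trans h

variable [HasSolidNorm F]

theorem norm_le_norm_of_nonneg_of_le {a b : F} (ha : 0 ≤ a) (h : a ≤ b) : ‖a‖ ≤ ‖b‖ :=
  norm_le_norm_of_abs_le_abs (by rwa [abs_of_nonneg ha, abs_of_nonneg (ha.trans h)])

theorem norm_le_norm_inf_add_norm_sub (a u : F) : ‖a‖ ≤ ‖|a| ⊓ u‖ + ‖|a| - |a| ⊓ u‖ := by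
  calc ‖a‖ = ‖|a| ⊓ u + (|a| - |a| ⊓ u)‖ := by rw [add_sub_cancel, norm_abs_eq_norm]
    _ ≤ _ := norm_add_le _ _

theorem tendsto_inf_abs_of_isLwcSet {x : F} (hx : IsLwcSet {x}) {a : ℕ → F}
    (ha : ∀ m n, m ≠ n → |a m| ⊓ |a n| = 0) :
    Tendsto (fun n => |a n| ⊓ |x|) atTop (𝓝 0) := by
  have h0 : ∀ n, 0 ≤ |a n| ⊓ |x| := fun n => le_inf (abs_nonneg _) (abs_nonneg _)
  refine isLwcSet_singleton_iff.1 hx _ (fun n => ?_) fun m n hmn => ?_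
  · rw [abs_of_nonneg (h0 n)]
    exact inf_le_right
  · rw [abs_of_nonneg (h0 m), abs_of_nonneg (h0 n)]
    exact inf_eq_zero_of_le (h0 m) (h0 n) inf_le_left inf_le_left (ha m n hmn)

theorem isLwcSet_singleton_add {x y : F} (hx : IsLwcSet {x}) (hy : IsLwcSet {y}) :
    IsLwcSet {x + y} := by
  refine isLwcSet_singleton_iff.2 fun a ha hd => ?_
  have h0 : ∀ n, 0 ≤ |a n| - |a n| ⊓ |x| := fun n => sub_nonneg.2 inf_le_left
  have hc : Tendsto (fun n => |a n| - |a n| ⊓ |x|) atTop (𝓝 0) := by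
    refine isLwcSet_singleton_iff.1 hy _ (fun n => ?_) fun m n hmn => ?_
    · rw [abs_of_nonneg (h0 n)]
      exact abs_sub_inf_le (abs_nonneg _) ((ha n).trans (abs_add_le x y))
    · rw [abs_of_nonneg (h0 m), abs_of_nonneg (h0 n)]
      exact inf_eq_zero_of_le (h0 m) (h0 n)
        (sub_le_self _ (le_inf (abs_nonneg _) (abs_nonneg _)))
        (sub_le_self _ (le_inf (abs_nonneg _) (abs_nonneg _))) (hd m n hmn)
  refine squeeze_zero_norm (fun n => norm_le_norm_inf_add_norm_sub (a n) |x|) ?_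
  simpa using (tendsto_inf_abs_of_isLwcSet hx hd).norm.add hc.norm

theorem isLwcSet_singleton_of_tendsto {x : ℕ → F} {z : F} (hx : ∀ n, IsLwcSet {x n})
    (h : Tendsto x atTop (𝓝 z)) : IsLwcSet {z} := by
  refine isLwcSet_singleton_iff.2 fun a ha hd => ?_
  rw [Metric.tendsto_atTop'] at h ⊢
  intro ε hε
  obtain ⟨N, hN⟩ := h (ε / 2) (half_pos hε)
  have hN := hN (N + 1) N.lt_succ_self
  have ht := tendsto_inf_abs_of_isLwcSet (hx (N + 1)) hd
  rw [Metric.tendsto_atTop'] at ht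
  obtain ⟨K, hK⟩ := ht (ε / 2) (half_pos hε)
  refine ⟨K, fun n hn => ?_⟩
  have h₁ := hK n hn
  have h₂ : ‖|a n| - |a n| ⊓ |x (N + 1)|‖ ≤ ‖x (N + 1) - z‖ := by
    rw [norm_sub_rev (x (N + 1)), ← norm_abs_eq_norm (z - x (N + 1))]
    refine norm_le_norm_of_nonneg_of_le (sub_nonneg.2 inf_le_left)
      (abs_sub_inf_le (abs_nonneg _) ((ha n).trans ?_))
    simpa using abs_add_le (x (N + 1)) (z - x (N + 1))
  have h₃ := norm_le_norm_inf_add_norm_sub (a n) |x (N + 1)|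
  rw [dist_zero_right] at h₁ ⊢
  rw [dist_eq_norm] at hN
  linarith

theorem isLwcSet_singleton_neg {x : F} (hx : IsLwcSet {x}) : IsLwcSet {-x} :=
  isLwcSet_singleton_of_abs_le hx (abs_neg x).le

theorem isLwcSet_singleton_smul [NormedSpace ℝ F] [IsOrderedModule ℝ F] {x : F} (hx : IsLwcSet {x}) (c : ℝ) :
    IsLwcSet {c • x} := by
  have hn : ∀ n : ℕ, IsLwcSet {n • |x|} := fun n => by
    induction n with
    | zero => exact isLwcSet_singleton_of_abs_le hx (by simp)
    | succ n ih =>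
      rw [succ_nsmul]
      exact isLwcSet_singleton_add ih (isLwcSet_singleton_of_abs_le hx (abs_abs x).le)
  obtain ⟨n, hn'⟩ := exists_nat_ge |c|
  refine isLwcSet_singleton_of_abs_le (hn n) ?_
  rw [abs_real_smul, abs_of_nonneg (nsmul_nonneg (abs_nonneg x) n), ← Nat.cast_smul_eq_nsmul ℝ]
  exact smul_le_smul_of_nonneg_right hn' (abs_nonneg x)

end LwcElement

/-! ### Limitedly L-weakly compact operators -/

section LimitedlyLwc

variable {X F : Type*} [NormedAddCommGroup X] [NormedSpace ℝ X]
  [NormedAddCommGroup F] [NormedSpace ℝ F] [Lattice F]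

theorem isLimitedSet_singleton (x : X) : IsLimitedSet {x} := by
  refine ⟨Bornology.isBounded_singleton, fun f hf => ?_⟩
  rw [tendstoUniformlyOn_singleton_iff_tendsto]
  exact ((WeakDual.eval_continuous x).tendsto 0).comp hf

variable [IsOrderedAddMonoid F] [HasSolidNorm F] [IsOrderedModule ℝ F]

/-- The norms of the elements of the solid interval of `y` lying in the ideal generated by `b`. -/
def idealNormSet (b y : F) : Set ℝ :=
  {r | ∃ z : F, |z| ≤ |y| ∧ (∃ k : ℝ, 0 ≤ k ∧ |z| ≤ k • |b|) ∧ ‖z‖ = r}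

/-- The norm of the component of `y` in the ideal generated by `b`. -/
noncomputable def idealSeminorm (b y : F) : ℝ := sSup (idealNormSet b y)

theorem norm_mem_upperBounds_idealNormSet (b y : F) : ‖y‖ ∈ upperBounds (idealNormSet b y) := by
  rintro _ ⟨z, hz, -, rfl⟩
  exact norm_le_norm_of_abs_le_abs hz

theorem zero_mem_idealNormSet (b y : F) : 0 ∈ idealNormSet b y :=
  ⟨0, by simp, ⟨0, le_rfl, by simp⟩, norm_zero⟩

theorem le_idealSeminorm {b y z : F} {k : ℝ} (hk : 0 ≤ k) (hz : |z| ≤ |y|)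
    (hzb : |z| ≤ k • |b|) : ‖z‖ ≤ idealSeminorm b y :=
  le_csSup ⟨_, norm_mem_upperBounds_idealNormSet b y⟩ ⟨z, hz, ⟨k, hk, hzb⟩, rfl⟩

theorem idealSeminorm_le {b y : F} {r : ℝ}
    (h : ∀ (z : F) (k : ℝ), 0 ≤ k → |z| ≤ |y| → |z| ≤ k • |b| → ‖z‖ ≤ r) :
    idealSeminorm b y ≤ r := by
  refine csSup_le ⟨0, zero_mem_idealNormSet b y⟩ ?_
  rintro _ ⟨z, hz, ⟨k, hk, hzb⟩, rfl⟩
  exact h z k hk hz hzb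

theorem idealSeminorm_nonneg (b y : F) : 0 ≤ idealSeminorm b y :=
  le_csSup ⟨_, norm_mem_upperBounds_idealNormSet b y⟩ (zero_mem_idealNormSet b y)

theorem idealSeminorm_le_norm (b y : F) : idealSeminorm b y ≤ ‖y‖ :=
  csSup_le ⟨0, zero_mem_idealNormSet b y⟩ (norm_mem_upperBounds_idealNormSet b y)

theorem idealSeminorm_add_le (b x y : F) :
    idealSeminorm b (x + y) ≤ idealSeminorm b x + idealSeminorm b y := by
  refine idealSeminorm_le fun z k hk hz hzb => ?_
  have h0 : 0 ≤ |z| ⊓ |x| := le_inf (abs_nonneg _) (abs_nonneg _)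
  have h1 : 0 ≤ |z| - |z| ⊓ |x| := sub_nonneg.2 inf_le_left
  refine (norm_le_norm_inf_add_norm_sub z |x|).trans (add_le_add ?_ ?_)
  · refine le_idealSeminorm hk ?_ ?_ <;> rw [abs_of_nonneg h0]
    exacts [inf_le_right, inf_le_left.trans hzb]
  · refine le_idealSeminorm hk ?_ ?_ <;> rw [abs_of_nonneg h1]
    · exact abs_sub_inf_le (abs_nonneg _) (hz.trans (abs_add_le x y))
    · exact (sub_le_self _ h0).trans hzb

theorem idealSeminorm_smul_le (b y : F) (c : ℝ) :
    idealSeminorm b (c • y) ≤ ‖c‖ * idealSeminorm b y := by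
  rcases eq_or_ne c 0 with rfl | hc
  · simpa using idealSeminorm_le_norm b (0 : F)
  refine idealSeminorm_le fun z k hk hz hzb => ?_
  have hc' : 0 < |c| := abs_pos.2 hc
  rw [← div_le_iff₀' (norm_pos_iff.2 hc), div_eq_inv_mul, ← norm_inv, ← norm_smul]
  refine le_idealSeminorm (k := |c|⁻¹ * k) (by positivity) ?_ ?_ <;> rw [abs_real_smul, abs_inv]
  · rw [inv_smul_le_iff_of_pos hc']
    rwa [abs_real_smul] at hz
  · rw [mul_smul]
    exact smul_le_smul_of_nonneg_left hzb (by positivity)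

theorem norm_le_idealSeminorm {b y : F} (h : |b| ≤ |y|) : ‖b‖ ≤ idealSeminorm b y :=
  le_idealSeminorm zero_le_one h (by rw [one_smul])

theorem tendsto_idealSeminorm {y : F} (hy : IsLwcSet {y}) {b : ℕ → F}
    (hb : ∀ m n, m ≠ n → |b m| ⊓ |b n| = 0) :
    Tendsto (fun n => idealSeminorm (b n) y) atTop (𝓝 0) := by
  have hex : ∀ n : ℕ, ∃ z : F, |z| ≤ |y| ∧ (∃ k : ℝ, 0 ≤ k ∧ |z| ≤ k • |b n|) ∧
      idealSeminorm (b n) y < ‖z‖ + 1 / ((n : ℝ) + 1) := fun n => by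
    obtain ⟨_, ⟨z, hz, hk, rfl⟩, h⟩ := exists_lt_of_lt_csSup
      ⟨0, zero_mem_idealNormSet (b n) y⟩
      (show idealSeminorm (b n) y - 1 / ((n : ℝ) + 1) < sSup (idealNormSet (b n) y) from
        sub_lt_self _ (by positivity))
    exact ⟨z, hz, hk, by linarith⟩
  choose z hz hk hlt using hex
  have ht : Tendsto z atTop (𝓝 0) := by
    refine isLwcSet_singleton_iff.1 hy z hz fun m n hmn => ?_
    obtain ⟨k, hk0, hk'⟩ := hk m
    obtain ⟨l, hl0, hl⟩ := hk n
    exact inf_eq_zero_of_le (abs_nonneg _) (abs_nonneg _) hk' hl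
      (smul_inf_smul_eq_zero (abs_nonneg _) (abs_nonneg _) hk0 hl0 (hb m n hmn))
  refine squeeze_zero (fun n => idealSeminorm_nonneg _ _) (fun n => (hlt n).le) ?_
  simpa using ht.norm.add tendsto_one_div_add_atTop_nhds_zero_nat

/-- The seminorm `y ↦ idealSeminorm b y`. -/
noncomputable def idealSeminormBundled (b : F) : Seminorm ℝ F :=
  Seminorm.ofSMulLE (idealSeminorm b)
    (le_antisymm (by simpa using idealSeminorm_le_norm b (0 : F)) (idealSeminorm_nonneg b 0))
    (idealSeminorm_add_le b) (fun c y => idealSeminorm_smul_le b y c)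

theorem Seminorm.exists_dual_apply_eq {V : Type*} [AddCommGroup V] [Module ℝ V]
    (p : Seminorm ℝ V) (x : V) : ∃ g : V →ₗ[ℝ] ℝ, (∀ y, |g y| ≤ p y) ∧ g x = p x := by
  rcases eq_or_ne x 0 with rfl | hx
  · exact ⟨0, fun y => by simp, by simp⟩
  obtain ⟨g, hg, hgp⟩ := exists_extension_of_le_sublinear
    (LinearPMap.mkSpanSingleton (K := ℝ) x (p x) hx) p
    (fun c hc y => by rw [map_smul_eq_mul, Real.norm_of_nonneg hc.le])
    (fun y z => map_add_le_add p y z) (by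
      rintro ⟨y, hy⟩
      obtain ⟨c, rfl⟩ := Submodule.mem_span_singleton.1 hy
      refine (LinearPMap.mkSpanSingleton'_apply x (p x) _ c hy).trans_le ?_
      rw [map_smul_eq_mul]
      exact mul_le_mul_of_nonneg_right (Real.le_norm_self c) (apply_nonneg p x))
  refine ⟨g, fun y => abs_le'.2 ⟨hgp y, ?_⟩, ?_⟩
  · rw [← map_neg, ← map_neg_eq_map p]
    exact hgp (-y)
  · have := hg ⟨x, Submodule.mem_span_singleton_self x⟩
    rw [this]
    exact LinearPMap.mkSpanSingleton'_apply_self _ _ _ _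

/-- An operator is l-Lwc iff it takes values in the elements of order continuous norm. -/
theorem isLimitedlyLwc_iff {T : X →L[ℝ] F} : IsLimitedlyLwc T ↔ ∀ x, IsLwcSet {T x} := by
  refine ⟨fun h x => by simpa using h _ (isLimitedSet_singleton x), fun h A hA b hb hd => ?_⟩
  simp only [Set.mem_iUnion, Set.mem_image, exists_prop, neg_abs_le_iff_abs_le] at hb
  have hb' : ∀ n, ∃ x ∈ A, |b n| ≤ |T x| := fun n => by
    obtain ⟨_, ⟨x, hx, rfl⟩, h⟩ := hb n
    exact ⟨x, hx, h⟩
  choose x hxA hx using hb'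
  choose g hg hgx using fun n => (idealSeminormBundled (b n)).exists_dual_apply_eq (T (x n))
  have hgn : ∀ n y, |g n y| ≤ idealSeminorm (b n) y := hg
  let G : ℕ → F →L[ℝ] ℝ := fun n => (g n).mkContinuous 1 fun y => by
    rw [one_mul]
    exact (hgn n y).trans (idealSeminorm_le_norm _ _)
  let f : ℕ → WeakDual ℝ X := fun n => StrongDual.toWeakDual ((G n).comp T)
  have hf : Tendsto f atTop (𝓝 0) := by
    rw [tendsto_iff_forall_eval_tendsto_topDualPairing]
    intro y
    exact squeeze_zero_norm (fun n => hgn n (T y)) (tendsto_idealSeminorm (h y) hd)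
  have hu := Metric.tendstoUniformlyOn_iff.1 (hA.2 f hf)
  rw [Metric.tendsto_nhds]
  intro ε hε
  filter_upwards [hu ε hε] with n hn
  have h₁ : |g n (T (x n))| < ε := by
    have := hn (x n) (hxA n)
    rwa [dist_comm, dist_zero_right] at this
  rw [dist_zero_right]
  calc ‖b n‖ ≤ idealSeminorm (b n) (T (x n)) := norm_le_idealSeminorm (hx n)
    _ = g n (T (x n)) := (hgx n).symm
    _ ≤ _ := le_abs_self _
    _ < ε := h₁

end LimitedlyLwc

section LimitedlyLwcAlgebra

variable {X F : Type*} [NormedAddCommGroup X] [NormedSpace ℝ X]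
  [NormedAddCommGroup F] [NormedSpace ℝ F] [Lattice F]
  [IsOrderedAddMonoid F] [HasSolidNorm F] [IsOrderedModule ℝ F]

theorem isLimitedlyLwc_zero : IsLimitedlyLwc (0 : X →L[ℝ] F) :=
  isLimitedlyLwc_iff.2 fun _ => isLwcSet_singleton_iff.2 fun a ha _ => by
    have : a = 0 := funext fun n => norm_le_zero_iff.1
      ((norm_le_norm_of_abs_le_abs (ha n)).trans (by simp))
    rw [this]
    exact tendsto_const_nhds

theorem IsLimitedlyLwc.add {S T : X →L[ℝ] F} (hS : IsLimitedlyLwc S) (hT : IsLimitedlyLwc T) :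
    IsLimitedlyLwc (S + T) :=
  isLimitedlyLwc_iff.2 fun x =>
    isLwcSet_singleton_add (isLimitedlyLwc_iff.1 hS x) (isLimitedlyLwc_iff.1 hT x)

theorem IsLimitedlyLwc.sub {S T : X →L[ℝ] F} (hS : IsLimitedlyLwc S) (hT : IsLimitedlyLwc T) :
    IsLimitedlyLwc (S - T) :=
  isLimitedlyLwc_iff.2 fun x => by
    rw [sub_apply, sub_eq_add_neg]
    exact isLwcSet_singleton_add (isLimitedlyLwc_iff.1 hS x)
      (isLwcSet_singleton_neg (isLimitedlyLwc_iff.1 hT x))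

theorem IsLimitedlyLwc.smul {T : X →L[ℝ] F} (hT : IsLimitedlyLwc T) (c : ℝ) :
    IsLimitedlyLwc (c • T) :=
  isLimitedlyLwc_iff.2 fun x => isLwcSet_singleton_smul (isLimitedlyLwc_iff.1 hT x) c

theorem IsLimitedlyLwc.comp {Y : Type*} [NormedAddCommGroup Y] [NormedSpace ℝ Y]
    {T : X →L[ℝ] F} (hT : IsLimitedlyLwc T) (S : Y →L[ℝ] X) : IsLimitedlyLwc (T.comp S) :=
  isLimitedlyLwc_iff.2 fun y => isLimitedlyLwc_iff.1 hT (S y)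

end LimitedlyLwcAlgebra

/-! ### Dominated operators -/

section Dominated

variable {E F : Type*} [NormedAddCommGroup E] [NormedSpace ℝ E] [Lattice E]
  [IsOrderedAddMonoid E] [HasSolidNorm E] [IsOrderedModule ℝ E]
  [NormedAddCommGroup F] [NormedSpace ℝ F] [Lattice F]
  [IsOrderedAddMonoid F] [HasSolidNorm F] [IsOrderedModule ℝ F]

/-- The operator `T` is dominated by `R`: `|T x| ≤ R |x|` for all `x`. -/
def IsDominatedBy (T R : E →L[ℝ] F) : Prop := ∀ x, |T x| ≤ R |x|

theorem abs_apply_le_of_nonneg {T R : E →ₗ[ℝ] F} (h : ∀ x, 0 ≤ x → |T x| ≤ R x) (x : E) :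
    |T x| ≤ R |x| := by
  calc |T x| = |T x⁺ + -T x⁻| := by rw [← sub_eq_add_neg, ← map_sub, posPart_sub_negPart]
    _ ≤ |T x⁺| + |T x⁻| := by simpa using abs_add_le (T x⁺) (-T x⁻)
    _ ≤ R x⁺ + R x⁻ := add_le_add (h _ (posPart_nonneg x)) (h _ (negPart_nonneg x))
    _ = R |x| := by rw [← map_add, posPart_add_negPart]

theorem isDominatedBy_of_nonneg {T R : E →L[ℝ] F} (h : ∀ x, 0 ≤ x → |T x| ≤ R x) :
    IsDominatedBy T R :=
  abs_apply_le_of_nonneg (T := (T : E →ₗ[ℝ] F)) (R := (R : E →ₗ[ℝ] F)) h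

theorem IsDominatedBy.abs_apply_le {T R : E →L[ℝ] F} (h : IsDominatedBy T R) {x : E}
    (hx : 0 ≤ x) : |T x| ≤ R x := by
  simpa [abs_of_nonneg hx] using h x

theorem IsDominatedBy.isPositiveOperator {T R : E →L[ℝ] F} (h : IsDominatedBy T R) :
    IsPositiveOperator R :=
  fun _ hx => (abs_nonneg _).trans (h.abs_apply_le hx)

theorem IsPositiveOperator.isDominatedBy {T : E →L[ℝ] F} (h : IsPositiveOperator T) :
    IsDominatedBy T T :=
  isDominatedBy_of_nonneg fun x hx => (abs_of_nonneg (h x hx)).le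

theorem IsPositiveOperator.mono {T : E →L[ℝ] F} (h : IsPositiveOperator T) {x y : E}
    (hxy : x ≤ y) : T x ≤ T y := by
  rw [← sub_nonneg, ← map_sub]
  exact h _ (sub_nonneg.2 hxy)

theorem IsDominatedBy.norm_le {T R : E →L[ℝ] F} (h : IsDominatedBy T R) : ‖T‖ ≤ ‖R‖ := by
  refine T.opNorm_le_bound (norm_nonneg _) fun x => ?_
  calc ‖T x‖ = ‖|T x|‖ := (norm_abs_eq_norm _).symm
    _ ≤ ‖R |x|‖ := norm_le_norm_of_nonneg_of_le (abs_nonneg _) (h x)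
    _ ≤ ‖R‖ * ‖x‖ := by simpa [norm_abs_eq_norm] using R.le_opNorm |x|

theorem IsDominatedBy.add {S T Q R : E →L[ℝ] F} (hS : IsDominatedBy S Q)
    (hT : IsDominatedBy T R) : IsDominatedBy (S + T) (Q + R) :=
  fun x => (abs_add_le _ _).trans (add_le_add (hS x) (hT x))

theorem IsDominatedBy.neg {T R : E →L[ℝ] F} (hT : IsDominatedBy T R) : IsDominatedBy (-T) R :=
  fun x => by simpa using hT x

theorem IsDominatedBy.sub {S T Q R : E →L[ℝ] F} (hS : IsDominatedBy S Q)
    (hT : IsDominatedBy T R) : IsDominatedBy (S - T) (Q + R) := by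
  rw [sub_eq_add_neg]
  exact hS.add hT.neg

theorem IsDominatedBy.smul {T R : E →L[ℝ] F} (hT : IsDominatedBy T R) (c : ℝ) :
    IsDominatedBy (c • T) (|c| • R) := fun x => by
  rw [smul_apply, smul_apply, abs_real_smul]
  exact smul_le_smul_of_nonneg_left (hT x) (abs_nonneg c)

theorem IsDominatedBy.comp {G : Type*} [NormedAddCommGroup G] [NormedSpace ℝ G] [Lattice G]
    [IsOrderedAddMonoid G] [HasSolidNorm G] [IsOrderedModule ℝ G] {S Q : F →L[ℝ] G}
    {T R : E →L[ℝ] F} (hS : IsDominatedBy S Q) (hT : IsDominatedBy T R) :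
    IsDominatedBy (S.comp T) (Q.comp R) :=
  fun x => (hS (T x)).trans (hS.isPositiveOperator.mono (hT x))

theorem HasSum.isDominatedBy {S T : ℕ → E →L[ℝ] F} {A B : E →L[ℝ] F} (hS : HasSum S A)
    (hT : HasSum T B) (h : ∀ n, IsDominatedBy (S n) (T n)) : IsDominatedBy A B := by
  have key : ∀ (V : ℕ → E →L[ℝ] F) (C : E →L[ℝ] F), HasSum V C → ∀ x,
      HasSum (fun n => V n x) (C x) := fun V C hV x =>
    (ContinuousLinearMap.apply ℝ F x).hasSum hV
  refine fun x => abs_le'.2 ⟨?_, ?_⟩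
  · exact hasSum_le (fun n => (le_abs_self _).trans (h n x)) (key S A hS x) (key T B hT |x|)
  · exact hasSum_le (fun n => (neg_le_abs _).trans (h n x)) (key S A hS x).neg
      (key T B hT |x|)

/-- The domination property of l-Lwc operators. -/
theorem IsDominatedBy.isLimitedlyLwc {T R : E →L[ℝ] F} (h : IsDominatedBy T R)
    (hR : IsLimitedlyLwc R) : IsLimitedlyLwc T :=
  isLimitedlyLwc_iff.2 fun x => isLwcSet_singleton_of_abs_le (isLimitedlyLwc_iff.1 hR |x|)
    ((h x).trans (le_abs_self _))

theorem isRegularlyLimitedlyLwc_iff {T : E →L[ℝ] F} :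
    IsRegularlyLimitedlyLwc T ↔ ∃ R, IsDominatedBy T R ∧ IsLimitedlyLwc R := by
  constructor
  · rintro ⟨A, B, hA, hA', hB, hB', rfl⟩
    exact ⟨A + B, hA.isDominatedBy.sub hB.isDominatedBy, hA'.add hB'⟩
  · rintro ⟨R, h, hR⟩
    refine ⟨R, R - T, h.isPositiveOperator, hR, fun x hx => sub_nonneg.2 ?_,
      hR.sub (h.isLimitedlyLwc hR), by abel⟩
    exact (le_abs_self _).trans (h.abs_apply_le hx)

variable (E) in
/-- The algebra of r-l-Lwc operators. -/
def regularlyLimitedlyLwcOperators : NonUnitalSubalgebra ℝ (E →L[ℝ] E) where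
  carrier := {T | IsRegularlyLimitedlyLwc T}
  zero_mem' := isRegularlyLimitedlyLwc_iff.2 ⟨0, fun x => by simp, isLimitedlyLwc_zero⟩
  add_mem' := by
    intro S T hS hT
    obtain ⟨Q, hQ, hQ'⟩ := isRegularlyLimitedlyLwc_iff.1 hS
    obtain ⟨R, hR, hR'⟩ := isRegularlyLimitedlyLwc_iff.1 hT
    exact isRegularlyLimitedlyLwc_iff.2 ⟨Q + R, hQ.add hR, hQ'.add hR'⟩
  mul_mem' := by
    intro S T hS hT
    obtain ⟨Q, hQ, hQ'⟩ := isRegularlyLimitedlyLwc_iff.1 hS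
    obtain ⟨R, hR, hR'⟩ := isRegularlyLimitedlyLwc_iff.1 hT
    exact isRegularlyLimitedlyLwc_iff.2 ⟨Q.comp R, hQ.comp hR, hQ'.comp R⟩
  smul_mem' := by
    intro c T hT
    obtain ⟨R, hR, hR'⟩ := isRegularlyLimitedlyLwc_iff.1 hT
    exact isRegularlyLimitedlyLwc_iff.2 ⟨|c| • R, hR.smul c, hR'.smul _⟩

theorem isRegularlyLimitedlyLwc_subset_regularOperators :
    {T : E →L[ℝ] E | IsRegularlyLimitedlyLwc T} ⊆ (RegularOperators E : Set (E →L[ℝ] E)) := by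
  rintro _ ⟨A, B, hA, -, hB, -, rfl⟩
  exact ⟨A, B, hA, hB, rfl⟩

theorem isRegularlyLimitedlyLwc_eq_regularOperators_iff :
    {T : E →L[ℝ] E | IsRegularlyLimitedlyLwc T} = (RegularOperators E : Set (E →L[ℝ] E)) ↔
      IsLimitedlyLwc (ContinuousLinearMap.id ℝ E) := by
  constructor
  · intro h
    have h1 : (1 : E →L[ℝ] E) ∈ (RegularOperators E : Set (E →L[ℝ] E)) :=
      (RegularOperators E).one_mem
    rw [← h] at h1
    obtain ⟨A, B, -, hA, -, hB, hAB⟩ := h1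
    have h2 := hA.sub hB
    rwa [← hAB] at h2
  · intro h
    refine isRegularlyLimitedlyLwc_subset_regularOperators.antisymm ?_
    rintro _ ⟨A, B, hA, hB, rfl⟩
    exact ⟨A, B, hA, h.comp A, hB, h.comp B, rfl⟩

end Dominated

/-! ### The Riesz–Kantorovich theorem -/

section RieszKantorovich

variable {E F : Type*} [NormedAddCommGroup E] [NormedSpace ℝ E] [Lattice E]
  [IsOrderedAddMonoid E] [HasSolidNorm E] [IsOrderedModule ℝ E]
  [NormedAddCommGroup F] [NormedSpace ℝ F] [Lattice F]
  [IsOrderedAddMonoid F] [HasSolidNorm F] [IsOrderedModule ℝ F]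

theorem exists_linearMap_eq_of_nonneg (m : E → F)
    (hadd : ∀ x y, 0 ≤ x → 0 ≤ y → m (x + y) = m x + m y)
    (hsmul : ∀ (c : ℝ) x, 0 ≤ c → 0 ≤ x → m (c • x) = c • m x) :
    ∃ L : E →ₗ[ℝ] F, ∀ x, 0 ≤ x → L x = m x := by
  have key : ∀ a b c d, 0 ≤ a → 0 ≤ b → 0 ≤ c → 0 ≤ d → a - b = c - d →
      m a - m b = m c - m d := fun a b c d ha hb hc hd h => by
    rw [sub_eq_sub_iff_add_eq_add] at h ⊢
    rw [← hadd a d ha hd, ← hadd c b hc hb, h]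
  refine ⟨⟨⟨fun x => m x⁺ - m x⁻, fun x y => ?_⟩, fun c x => ?_⟩, fun x hx => ?_⟩
  · have hp := fun x : E => posPart_nonneg x
    have hn := fun x : E => negPart_nonneg x
    rw [sub_add_sub_comm, ← hadd _ _ (hp x) (hp y), ← hadd _ _ (hn x) (hn y)]
    refine key _ _ _ _ (hp _) (hn _) (add_nonneg (hp x) (hp y)) (add_nonneg (hn x) (hn y)) ?_
    rw [← sub_add_sub_comm, posPart_sub_negPart, posPart_sub_negPart, posPart_sub_negPart]
  · have hp := fun x : E => posPart_nonneg x
    have hn := fun x : E => negPart_nonneg x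
    simp only [RingHom.id_apply]
    rcases le_total 0 c with hc | hc
    · rw [smul_sub, ← hsmul _ _ hc (hp x), ← hsmul _ _ hc (hn x)]
      refine key _ _ _ _ (hp _) (hn _) (smul_nonneg hc (hp x)) (smul_nonneg hc (hn x)) ?_
      rw [← smul_sub, posPart_sub_negPart, posPart_sub_negPart]
    · have hc' := neg_nonneg.2 hc
      rw [show c • (m x⁺ - m x⁻) = (-c) • m x⁻ - (-c) • m x⁺ by module,
        ← hsmul _ _ hc' (hp x), ← hsmul _ _ hc' (hn x)]
      refine key _ _ _ _ (hp _) (hn _) (smul_nonneg hc' (hn x)) (smul_nonneg hc' (hp x)) ?_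
      rw [← smul_sub, ← neg_sub x⁺, posPart_sub_negPart, posPart_sub_negPart, smul_neg, neg_smul,
        neg_neg]
  · have h0 : m 0 = 0 := by simpa using hsmul 0 0 le_rfl le_rfl
    change m x⁺ - m x⁻ = m x
    rw [posPart_of_nonneg hx, negPart_of_nonneg hx, h0, sub_zero]

theorem exists_modulus_apply (hF : IsDedekindComplete F) {T R : E →L[ℝ] F}
    (h : IsDominatedBy T R) :
    ∃ M : E →L[ℝ] F, ∀ x, 0 ≤ x → IsLUB (T '' {y | |y| ≤ x}) (M x) := by
  have hR : ∀ x, R x ∈ upperBounds (T '' {y | |y| ≤ x}) := by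
    rintro x _ ⟨y, hy, rfl⟩
    exact (le_abs_self _).trans ((h y).trans (h.isPositiveOperator.mono hy))
  have hex : ∀ x : E, ∃ u, 0 ≤ x → IsLUB (T '' {y | |y| ≤ x}) u := fun x => by
    by_cases hx : 0 ≤ x
    · obtain ⟨u, hu⟩ := hF (T '' {y | |y| ≤ x}) ⟨T 0, 0, by simpa using hx, rfl⟩ ⟨_, hR x⟩
      exact ⟨u, fun _ => hu⟩
    · exact ⟨0, fun h => absurd h hx⟩
  choose m hm using hex
  have hadd : ∀ x y, 0 ≤ x → 0 ≤ y → m (x + y) = m x + m y := fun x y hx hy => by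
    refine (hm _ (add_nonneg hx hy)).unique ?_
    convert (hm x hx).add (hm y hy) using 1
    ext z
    constructor
    · rintro ⟨w, hw, rfl⟩
      obtain ⟨a, b, ha, hb, rfl⟩ := exists_add_of_abs_le_add hx hy hw
      exact ⟨T a, ⟨a, ha, rfl⟩, T b, ⟨b, hb, rfl⟩, (map_add T a b).symm⟩
    · rintro ⟨_, ⟨a, ha, rfl⟩, _, ⟨b, hb, rfl⟩, rfl⟩
      exact ⟨a + b, (abs_add_le a b).trans (add_le_add ha hb), map_add T a b⟩
  have hsmul : ∀ (c : ℝ) x, 0 ≤ c → 0 ≤ x → m (c • x) = c • m x := fun c x hc hx => by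
    rcases hc.eq_or_lt with rfl | hc'
    · have := hadd 0 0 le_rfl le_rfl
      rw [add_zero, right_eq_add] at this
      simpa using this
    · refine (hm _ (smul_nonneg hc hx)).unique ?_
      have h1 := (OrderIso.smulRight (β := F) hc').isLUB_image'.2 (hm x hx)
      convert h1 using 1
      swap
      · rfl
      rw [Set.image_image]
      ext z
      constructor
      · rintro ⟨y, hy, rfl⟩
        refine ⟨c⁻¹ • y, ?_, ?_⟩
        · rw [Set.mem_ofPred_eq, abs_real_smul, abs_inv, abs_of_pos hc', inv_smul_le_iff_of_pos hc']
          exact hy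
        · simp [smul_smul, hc'.ne']
      · rintro ⟨y, hy, rfl⟩
        refine ⟨c • y, ?_, by simp⟩
        rw [Set.mem_ofPred_eq, abs_real_smul, abs_of_pos hc']
        exact smul_le_smul_of_nonneg_left hy hc
  obtain ⟨L, hL⟩ := exists_linearMap_eq_of_nonneg m hadd hsmul
  have hLR : ∀ x, 0 ≤ x → |L x| ≤ R x := fun x hx => by
    have h0 : 0 ≤ m x := (hm x hx).1 ⟨0, by simpa using hx, map_zero T⟩
    rw [hL x hx, abs_of_nonneg h0]
    exact (hm x hx).2 (hR x)
  have hLb : ∀ x, ‖L x‖ ≤ ‖R‖ * ‖x‖ := fun x => by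
    calc ‖L x‖ = ‖|L x|‖ := (norm_abs_eq_norm _).symm
      _ ≤ ‖R |x|‖ := norm_le_norm_of_nonneg_of_le (abs_nonneg _)
        (abs_apply_le_of_nonneg (R := (R : E →ₗ[ℝ] F)) hLR x)
      _ ≤ ‖R‖ * ‖x‖ := by simpa [norm_abs_eq_norm] using R.le_opNorm |x|
  refine ⟨L.mkContinuous ‖R‖ hLb, fun x hx => ?_⟩
  rw [LinearMap.mkContinuous_apply, hL x hx]
  exact hm x hx

end RieszKantorovich

/-! ### The Banach lattice of regular operators -/

section RegularOperators

variable {E : Type*} [NormedAddCommGroup E] [NormedSpace ℝ E] [Lattice E]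
  [IsOrderedAddMonoid E] [HasSolidNorm E] [IsOrderedModule ℝ E]

theorem RegularOperators.le_iff {S T : RegularOperators E} :
    S ≤ T ↔ ∀ x : E, 0 ≤ x → (S : E →L[ℝ] E) x ≤ (T : E →L[ℝ] E) x :=
  forall₂_congr fun _ _ => sub_nonneg

theorem IsPositiveOperator.mem_regularOperators {T : E →L[ℝ] E} (h : IsPositiveOperator T) :
    T ∈ RegularOperators E :=
  ⟨T, 0, h, fun x _ => by simp, by simp⟩

theorem exists_isDominatedBy (T : RegularOperators E) :
    ∃ R, IsDominatedBy (T : E →L[ℝ] E) R := by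
  obtain ⟨_, A, B, hA, hB, rfl⟩ := T
  exact ⟨A + B, hA.isDominatedBy.sub hB.isDominatedBy⟩

theorem IsDominatedBy.mem_regularOperators {T R : E →L[ℝ] E} (h : IsDominatedBy T R) :
    T ∈ RegularOperators E :=
  ⟨R, R - T, h.isPositiveOperator, fun x hx =>
    sub_nonneg.2 ((le_abs_self _).trans (h.abs_apply_le hx)), by abel⟩

theorem mem_upperBounds_pair_neg_iff {T R : RegularOperators E} :
    R ∈ upperBounds {T, -T} ↔ IsDominatedBy (T : E →L[ℝ] E) (R : E →L[ℝ] E) := by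
  constructor
  · intro h
    have h₁ := RegularOperators.le_iff.1 (h (Set.mem_insert _ _))
    have h₂ := RegularOperators.le_iff.1 (h (Set.mem_insert_of_mem _ rfl))
    exact isDominatedBy_of_nonneg fun x hx => abs_le'.2 ⟨h₁ x hx, h₂ x hx⟩
  · rintro h _ (rfl | rfl)
    · exact RegularOperators.le_iff.2 fun x hx => (le_abs_self _).trans (h.abs_apply_le hx)
    · exact RegularOperators.le_iff.2 fun x hx => (neg_le_abs _).trans (h.abs_apply_le hx)

variable (hE : IsDedekindComplete E)
include hE

/-- The modulus of a regular operator on a Dedekind complete Banach lattice exists. -/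
theorem isLUB_orderModulus (T : RegularOperators E) : IsLUB {T, -T} (orderModulus T) := by
  have hex : ∃ M, IsLUB {T, -T} M := by
    obtain ⟨R, hR⟩ := exists_isDominatedBy T
    obtain ⟨M, hM⟩ := exists_modulus_apply hE hR
    have hTM : IsDominatedBy (T : E →L[ℝ] E) M := isDominatedBy_of_nonneg fun x hx =>
      abs_le'.2 ⟨(hM x hx).1 ⟨x, (abs_of_nonneg hx).le, rfl⟩,
        (hM x hx).1 ⟨-x, by simp [abs_of_nonneg hx], map_neg _ x⟩⟩
    refine ⟨⟨M, hTM.isPositiveOperator.mem_regularOperators⟩,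
      mem_upperBounds_pair_neg_iff.2 hTM, fun S hS => RegularOperators.le_iff.2 fun x hx => ?_⟩
    have hS := mem_upperBounds_pair_neg_iff.1 hS
    refine (hM x hx).2 ?_
    rintro _ ⟨y, hy, rfl⟩
    exact (le_abs_self _).trans ((hS y).trans (hS.isPositiveOperator.mono hy))
  rw [orderModulus, dif_pos hex]
  exact hex.choose_spec

theorem isDominatedBy_orderModulus (T : RegularOperators E) :
    IsDominatedBy (T : E →L[ℝ] E) (orderModulus T : RegularOperators E) :=
  mem_upperBounds_pair_neg_iff.1 (isLUB_orderModulus hE T).1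

theorem isPositiveOperator_orderModulus (T : RegularOperators E) :
    IsPositiveOperator ((orderModulus T : RegularOperators E) : E →L[ℝ] E) :=
  (isDominatedBy_orderModulus hE T).isPositiveOperator

theorem IsDominatedBy.orderModulus_apply_le {T : RegularOperators E} {R : E →L[ℝ] E}
    (h : IsDominatedBy (T : E →L[ℝ] E) R) {x : E} (hx : 0 ≤ x) :
    ((orderModulus T : RegularOperators E) : E →L[ℝ] E) x ≤ R x :=
  RegularOperators.le_iff.1 ((isLUB_orderModulus hE T).2
    ((mem_upperBounds_pair_neg_iff
      (R := ⟨R, h.isPositiveOperator.mem_regularOperators⟩)).2 h)) x hx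

theorem IsDominatedBy.orderModulus_isDominatedBy {T : RegularOperators E} {R : E →L[ℝ] E}
    (h : IsDominatedBy (T : E →L[ℝ] E) R) :
    IsDominatedBy ((orderModulus T : RegularOperators E) : E →L[ℝ] E) R :=
  isDominatedBy_of_nonneg fun x hx => by
    rw [abs_of_nonneg (isPositiveOperator_orderModulus hE T x hx)]
    exact h.orderModulus_apply_le hE hx

theorem IsDominatedBy.regularNorm_le {T : RegularOperators E} {R : E →L[ℝ] E}
    (h : IsDominatedBy (T : E →L[ℝ] E) R) : regularNorm T ≤ ‖R‖ :=
  (h.orderModulus_isDominatedBy hE).norm_le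

theorem norm_le_regularNorm (T : RegularOperators E) : ‖(T : E →L[ℝ] E)‖ ≤ regularNorm T :=
  (isDominatedBy_orderModulus hE T).norm_le

theorem regularNorm_smul_le (c : ℝ) (T : RegularOperators E) :
    regularNorm (c • T) ≤ |c| * regularNorm T := by
  have h := IsDominatedBy.regularNorm_le hE (T := c • T)
    ((isDominatedBy_orderModulus hE T).smul c)
  rwa [norm_smul, Real.norm_eq_abs, abs_abs] at h

theorem regularNorm_smul (c : ℝ) (T : RegularOperators E) :
    regularNorm (c • T) = |c| * regularNorm T := by
  refine (regularNorm_smul_le hE c T).antisymm ?_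
  rcases eq_or_ne c 0 with rfl | hc
  · rw [abs_zero, zero_mul]
    exact norm_nonneg _
  · have h := regularNorm_smul_le hE c⁻¹ (c • T)
    rwa [inv_smul_smul₀ hc, abs_inv, ← div_eq_inv_mul, le_div_iff₀' (abs_pos.2 hc)] at h

theorem regularNorm_add_le (S T : RegularOperators E) :
    regularNorm (S + T) ≤ regularNorm S + regularNorm T :=
  (IsDominatedBy.regularNorm_le hE (T := S + T)
    ((isDominatedBy_orderModulus hE S).add (isDominatedBy_orderModulus hE T))).trans
    (norm_add_le _ _)

theorem regularNorm_mul_le (S T : RegularOperators E) :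
    regularNorm (S * T) ≤ regularNorm S * regularNorm T :=
  (IsDominatedBy.regularNorm_le hE (T := S * T)
    ((isDominatedBy_orderModulus hE S).comp (isDominatedBy_orderModulus hE T))).trans
    (ContinuousLinearMap.opNorm_comp_le _ _)

theorem regularNorm_sub_comm (S T : RegularOperators E) :
    regularNorm (S - T) = regularNorm (T - S) := by
  rw [← neg_sub T S, ← neg_one_smul ℝ (T - S), regularNorm_smul hE]
  simp

theorem IsDominatedBy.of_orderModulus_le {S T : RegularOperators E} {R : E →L[ℝ] E}
    (h : orderModulus S ≤ orderModulus T) (hT : IsDominatedBy (T : E →L[ℝ] E) R) :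
    IsDominatedBy (S : E →L[ℝ] E) R :=
  isDominatedBy_of_nonneg fun x hx =>
    ((isDominatedBy_orderModulus hE S).abs_apply_le hx).trans
      ((RegularOperators.le_iff.1 h x hx).trans (hT.orderModulus_apply_le hE hx))

theorem RegularOperators.exists_isLUB_pair (S T : RegularOperators E) :
    ∃ u, IsLUB {S, T} u := by
  have h := isDominatedBy_orderModulus hE (S - T)
  have hsum : ∀ x, ((S + T + orderModulus (S - T) : RegularOperators E) : E →L[ℝ] E) x =
      (S : E →L[ℝ] E) x + (T : E →L[ℝ] E) x +
        ((orderModulus (S - T) : RegularOperators E) : E →L[ℝ] E) x := fun _ => rfl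
  refine ⟨(2⁻¹ : ℝ) • (S + T + orderModulus (S - T)), ?_, fun U hU => ?_⟩
  · rintro _ (rfl | rfl) <;> refine RegularOperators.le_iff.2 fun x hx => ?_ <;>
      refine (le_inv_smul_iff_of_pos two_pos).2 (sub_nonneg.1 ?_)
    · refine (sub_nonneg.2 ((le_abs_self _).trans (h.abs_apply_le hx))).trans_eq ?_
      erw [hsum]
      rw [AddSubgroupClass.coe_sub, sub_apply, two_smul]
      abel
    · refine (sub_nonneg.2 ((neg_le_abs _).trans (h.abs_apply_le hx))).trans_eq ?_
      erw [hsum]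
      rw [AddSubgroupClass.coe_sub, sub_apply, two_smul]
      abel
  · have hS := RegularOperators.le_iff.1 (hU (Set.mem_insert _ _))
    have hT := RegularOperators.le_iff.1 (hU (Set.mem_insert_of_mem _ rfl))
    have hd : IsDominatedBy ((S - T : RegularOperators E) : E →L[ℝ] E)
        ((U : E →L[ℝ] E) + U - S - T) := by
      refine isDominatedBy_of_nonneg fun x hx => abs_le'.2 ⟨?_, ?_⟩ <;>
        refine sub_nonneg.1 ?_
      · refine (sub_nonneg.2 (add_le_add (hS x hx) (hS x hx))).trans_eq ?_
        simp only [AddSubgroupClass.coe_sub, sub_apply, add_apply]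
        abel
      · refine (sub_nonneg.2 (add_le_add (hT x hx) (hT x hx))).trans_eq ?_
        simp only [AddSubgroupClass.coe_sub, sub_apply, add_apply]
        abel
    refine RegularOperators.le_iff.2 fun x hx => ?_
    refine (inv_smul_le_iff_of_pos two_pos).2 (sub_nonneg.1 ?_)
    refine (sub_nonneg.2 (hd.orderModulus_apply_le hE hx)).trans_eq ?_
    erw [hsum]
    rw [sub_apply, sub_apply, add_apply, two_smul]
    abel

theorem RegularOperators.exists_isGLB_pair (S T : RegularOperators E) :
    ∃ u, IsGLB {S, T} u := by
  have hneg : ∀ A B : RegularOperators E, -A ≤ B ↔ -B ≤ A := fun A B => by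
    simp only [RegularOperators.le_iff, NegMemClass.coe_neg, neg_apply]
    exact forall₂_congr fun x _ => neg_le
  have hneg' : ∀ A B : RegularOperators E, A ≤ -B ↔ B ≤ -A := fun A B => by
    simp only [RegularOperators.le_iff, NegMemClass.coe_neg, neg_apply]
    exact forall₂_congr fun x _ => le_neg
  obtain ⟨u, hu⟩ := RegularOperators.exists_isLUB_pair hE (-S) (-T)
  refine ⟨-u, ?_, fun U hU => (hneg' _ _).1 (hu.2 ?_)⟩
  · rintro _ (rfl | rfl)
    · exact (hneg _ _).1 (hu.1 (Set.mem_insert _ _))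
    · exact (hneg _ _).1 (hu.1 (Set.mem_insert_of_mem _ rfl))
  · rintro _ (rfl | rfl)
    · exact (hneg' _ _).1 (by simpa using hU (Set.mem_insert _ _))
    · exact (hneg' _ _).1 (by simpa using hU (Set.mem_insert_of_mem _ rfl))

theorem regularNorm_complete [CompleteSpace E] (u : ℕ → RegularOperators E)
    (hu : ∀ ε : ℝ, 0 < ε →
      ∃ n₀, ∀ m, n₀ ≤ m → ∀ n, n₀ ≤ n → regularNorm (u m - u n) < ε) :
    ∃ T, Tendsto (fun n => regularNorm (u n - T)) atTop (𝓝 0) := by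
  choose N hN using fun k : ℕ => hu ((1 / 2) ^ k) (by positivity)
  obtain ⟨φ, hφ, hφN⟩ : ∃ φ : ℕ → ℕ, Monotone φ ∧ ∀ k, N k ≤ φ k :=
    ⟨fun k => (Finset.range (k + 1)).sup N,
      fun a b hab => Finset.sup_mono (Finset.range_mono (Nat.succ_le_succ hab)),
      fun k => Finset.le_sup (f := N) (Finset.self_mem_range_succ k)⟩
  let w : ℕ → RegularOperators E := fun k => u (φ (k + 1)) - u (φ k)
  let W : ℕ → E →L[ℝ] E := fun k => (w k : E →L[ℝ] E)
  let D : ℕ → E →L[ℝ] E := fun k => (orderModulus (w k) : RegularOperators E)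
  have hWD : ∀ k, IsDominatedBy (W k) (D k) := fun k => isDominatedBy_orderModulus hE (w k)
  have hDn : ∀ k, ‖D k‖ ≤ (1 / 2) ^ k := fun k =>
    (hN k _ ((hφN k).trans (hφ k.le_succ)) _ (hφN k)).le
  have hDs : Summable D := .of_norm_bounded summable_geometric_two hDn
  have hWs : Summable W := .of_norm_bounded summable_geometric_two fun k =>
    (hWD k).norm_le.trans (hDn k)
  have hdom : ∀ k, IsDominatedBy (∑' j, W (j + k)) (∑' j, D (j + k)) := fun k =>
    ((summable_nat_add_iff k).2 hWs).hasSum.isDominatedBy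
      ((summable_nat_add_iff k).2 hDs).hasSum fun j => hWD (j + k)
  let T : RegularOperators E := u (φ 0) + ⟨∑' j, W j, (hdom 0).mem_regularOperators⟩
  have hT : ∀ k, ((T - u (φ k) : RegularOperators E) : E →L[ℝ] E) = ∑' j, W (j + k) :=
    fun k => by
      have h₁ : ∑ j ∈ Finset.range k, W j =
          (u (φ k) : E →L[ℝ] E) - (u (φ 0) : E →L[ℝ] E) :=
        Finset.sum_range_sub (fun j => (u (φ j) : E →L[ℝ] E)) k
      have h₂ := hWs.sum_add_tsum_nat_add k
      have h₃ : ((T - u (φ k) : RegularOperators E) : E →L[ℝ] E) =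
        (u (φ 0) : E →L[ℝ] E) + ∑' j, W j - (u (φ k) : E →L[ℝ] E) := rfl
      rw [h₃, ← h₂, h₁]
      abel
  have hle : ∀ k, regularNorm (T - u (φ k)) ≤ ‖∑' j, D (j + k)‖ := fun k =>
    IsDominatedBy.regularNorm_le hE (by rw [hT k]; exact hdom k)
  have htail : Tendsto (fun k => ‖∑' j, D (j + k)‖) atTop (𝓝 0) := by
    simpa using (tendsto_sum_nat_add D).norm
  refine ⟨T, Metric.tendsto_atTop.2 fun ε hε => ?_⟩
  obtain ⟨K, hK⟩ := Metric.tendsto_atTop.1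
    (htail.add (tendsto_pow_atTop_nhds_zero_of_lt_one (r := (1 / 2 : ℝ)) (by norm_num)
      (by norm_num))) ε hε
  have hK := hK K le_rfl
  refine ⟨N K, fun n hn => ?_⟩
  have h₁ := hN K n hn (φ K) (hφN K)
  have h₂ := hle K
  have h₃ : regularNorm (u n - T) ≤ regularNorm (u n - u (φ K)) + regularNorm (T - u (φ K)) := by
    rw [regularNorm_sub_comm hE T, ← sub_add_sub_cancel (u n) (u (φ K)) T]
    exact regularNorm_add_le hE _ _
  rw [add_zero, Real.dist_0_eq_abs] at hK
  rw [Real.dist_0_eq_abs, abs_of_nonneg (show 0 ≤ regularNorm (u n - T) from norm_nonneg _)]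
  linarith [le_abs_self (‖∑' j, D (j + K)‖ + (1 / 2 : ℝ) ^ K)]

theorem isBanachLatticeNorm_regularNorm [CompleteSpace E] :
    IsBanachLatticeNorm (regularNorm : RegularOperators E → ℝ) where
  add_le_add_right S T U h := RegularOperators.le_iff.2 fun x hx =>
    add_le_add_left (RegularOperators.le_iff.1 h x hx) _
  smul_le_smul c S T hc h := RegularOperators.le_iff.2 fun x hx =>
    smul_le_smul_of_nonneg_left (RegularOperators.le_iff.1 h x hx) hc
  exists_sup := RegularOperators.exists_isLUB_pair hE
  exists_inf := RegularOperators.exists_isGLB_pair hE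
  nonneg T := norm_nonneg _
  eq_zero_iff T := by
    constructor
    · intro h
      exact Subtype.ext (norm_le_zero_iff.1 (h ▸ norm_le_regularNorm hE T))
    · rintro rfl
      simpa using regularNorm_smul hE 0 (0 : RegularOperators E)
  smul := regularNorm_smul hE
  add_le := regularNorm_add_le hE
  solid S T h := (IsDominatedBy.of_orderModulus_le hE h
    (isDominatedBy_orderModulus hE T)).regularNorm_le hE
  complete := regularNorm_complete hE

theorem isRegularlyLimitedlyLwc_iff_orderModulus {T : RegularOperators E} :
    IsRegularlyLimitedlyLwc (T : E →L[ℝ] E) ↔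
      IsLimitedlyLwc ((orderModulus T : RegularOperators E) : E →L[ℝ] E) := by
  rw [isRegularlyLimitedlyLwc_iff]
  constructor
  · rintro ⟨R, h, hR⟩
    exact (h.orderModulus_isDominatedBy hE).isLimitedlyLwc hR
  · exact fun h => ⟨_, isDominatedBy_orderModulus hE T, h⟩

theorem isDominatedBy_orderModulus_sub_orderModulus (S T : RegularOperators E) :
    IsDominatedBy (((orderModulus S : RegularOperators E) : E →L[ℝ] E) -
      ((orderModulus T : RegularOperators E) : E →L[ℝ] E))
      (orderModulus (S - T) : RegularOperators E) := by
  have h := isDominatedBy_orderModulus hE (S - T)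
  have h₁ : IsDominatedBy (S : E →L[ℝ] E) (((orderModulus T : RegularOperators E) : E →L[ℝ] E) +
      ((orderModulus (S - T) : RegularOperators E) : E →L[ℝ] E)) := by
    simpa using (isDominatedBy_orderModulus hE T).add h
  have h₂ : IsDominatedBy (T : E →L[ℝ] E) (((orderModulus S : RegularOperators E) : E →L[ℝ] E) +
      ((orderModulus (S - T) : RegularOperators E) : E →L[ℝ] E)) := by
    simpa using (isDominatedBy_orderModulus hE S).sub h
  refine isDominatedBy_of_nonneg fun x hx => abs_le'.2 ⟨?_, ?_⟩
  · exact sub_le_iff_le_add'.2 (h₁.orderModulus_apply_le hE hx)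
  · rw [sub_apply, neg_sub]
    exact sub_le_iff_le_add'.2 (h₂.orderModulus_apply_le hE hx)

theorem isRegularlyLimitedlyLwc_of_tendsto {u : ℕ → RegularOperators E}
    {T : RegularOperators E} (hu : ∀ n, IsRegularlyLimitedlyLwc (u n : E →L[ℝ] E))
    (h : Tendsto (fun n => regularNorm (u n - T)) atTop (𝓝 0)) :
    IsRegularlyLimitedlyLwc (T : E →L[ℝ] E) := by
  rw [isRegularlyLimitedlyLwc_iff_orderModulus hE]
  have hlim : Tendsto (fun n => ((orderModulus (u n) : RegularOperators E) : E →L[ℝ] E)) atTop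
      (𝓝 ((orderModulus T : RegularOperators E) : E →L[ℝ] E)) := by
    rw [tendsto_iff_norm_sub_tendsto_zero]
    exact squeeze_zero (fun n => norm_nonneg _)
      (fun n => (isDominatedBy_orderModulus_sub_orderModulus hE (u n) T).norm_le) h
  refine isLimitedlyLwc_iff.2 fun x => isLwcSet_singleton_of_tendsto
    (fun n => isLimitedlyLwc_iff.1 ((isRegularlyLimitedlyLwc_iff_orderModulus hE).1 (hu n)) x)
    (((ContinuousLinearMap.apply ℝ E x).continuous.tendsto _).comp hlim)

end RegularOperators

theorem mainTheorem5 {E : Type*} [NormedAddCommGroup E] [NormedSpace ℝ E] [Lattice E]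
    [IsOrderedAddMonoid E] [IsOrderedModule ℝ E] [HasSolidNorm E] [CompleteSpace E] :
    -- (i) the r-l-Lwc operators form a (not necessarily unital) subalgebra of `L_r(E)`,
    -- which is all of `L_r(E)` iff the identity is l-Lwc
    ({T : E →L[ℝ] E | IsRegularlyLimitedlyLwc T} ⊆ (RegularOperators E : Set (E →L[ℝ] E)) ∧
      (∃ A : NonUnitalSubalgebra ℝ (E →L[ℝ] E),
        (A : Set (E →L[ℝ] E)) = {T | IsRegularlyLimitedlyLwc T}) ∧
      ({T : E →L[ℝ] E | IsRegularlyLimitedlyLwc T} = (RegularOperators E : Set (E →L[ℝ] E)) ↔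
        IsLimitedlyLwc (ContinuousLinearMap.id ℝ E))) ∧
    -- (ii)
    (IsDedekindComplete E →
      -- `L_r(E)` with the regular norm `‖T‖_r = ‖ |T| ‖` is a Banach lattice
      (∀ T : RegularOperators E, IsLUB {T, -T} (orderModulus T)) ∧
      IsBanachLatticeNorm (regularNorm : RegularOperators E → ℝ) ∧
      -- the r-l-Lwc operators form an order ideal in `L_r(E)`
      (∃ I : Submodule ℝ (RegularOperators E),
        (I : Set (RegularOperators E)) =
          {T : RegularOperators E | IsRegularlyLimitedlyLwc (T : E →L[ℝ] E)}) ∧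
      (∀ S T : RegularOperators E, IsRegularlyLimitedlyLwc (T : E →L[ℝ] E) →
        orderModulus S ≤ orderModulus T → IsRegularlyLimitedlyLwc (S : E →L[ℝ] E)) ∧
      -- this ideal is closed for the regular norm
      (∀ (u : ℕ → RegularOperators E) (T : RegularOperators E),
        (∀ n, IsRegularlyLimitedlyLwc (u n : E →L[ℝ] E)) →
        Tendsto (fun n => regularNorm (u n - T)) atTop (𝓝 0) →
        IsRegularlyLimitedlyLwc (T : E →L[ℝ] E)) ∧
      -- it is complete for the regular norm
      (∀ u : ℕ → RegularOperators E,
        (∀ n, IsRegularlyLimitedlyLwc (u n : E →L[ℝ] E)) →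
        (∀ ε : ℝ, 0 < ε →
          ∃ n₀, ∀ m, n₀ ≤ m → ∀ n, n₀ ≤ n → regularNorm (u m - u n) < ε) →
        ∃ T : RegularOperators E, IsRegularlyLimitedlyLwc (T : E →L[ℝ] E) ∧
          Tendsto (fun n => regularNorm (u n - T)) atTop (𝓝 0)) ∧
      -- the regular norm is submultiplicative
      (∀ S T : RegularOperators E, regularNorm (S * T) ≤ regularNorm S * regularNorm T)) := by
  refine ⟨⟨isRegularlyLimitedlyLwc_subset_regularOperators,
    ⟨regularlyLimitedlyLwcOperators E, rfl⟩,
    isRegularlyLimitedlyLwc_eq_regularOperators_iff⟩, fun hE => ⟨isLUB_orderModulus hE,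
    isBanachLatticeNorm_regularNorm hE, ?_, fun S T hT h => ?_,
    fun u T => isRegularlyLimitedlyLwc_of_tendsto hE, fun u hu hc => ?_,
    regularNorm_mul_le hE⟩⟩
  · exact ⟨(regularlyLimitedlyLwcOperators E).toSubmodule.comap
      (RegularOperators E).val.toLinearMap, rfl⟩
  · obtain ⟨R, hR, hR'⟩ := isRegularlyLimitedlyLwc_iff.1 hT
    exact isRegularlyLimitedlyLwc_iff.2 ⟨R, .of_orderModulus_le hE h hR, hR'⟩
  · obtain ⟨T, hT⟩ := regularNorm_complete hE u hc
    exact ⟨T, isRegularlyLimitedlyLwc_of_tendsto hE hu hT, hT⟩
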